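/- **Adversarial bandits and GBPA.** Let $N\ge 2$ be the number of arms and $T$ the number of rounds. An oblivious adversary fixes gain vectors $g_1,\dots,g_T\in[-1,0]^N$ in advance. Given a differentiable convex function $\tilde\Phi:\mathbb R^N\to\mathbb R$ whose gradient always lies in the probability simplex $\Delta^N$, the algorithm GBPA$(\tilde\Phi)$ starts with $\hat G_0=0$ and, in each round $t=1,\dots,T$, draws an arm $i_t$ (conditionally on the past) from the distribution $p_t=\nabla\tilde\Phi(\hat G_{t-1})$, observes only $g_{t,i_t}$, and sets $\hat G_t=\hat G_{t-1}+\frac{g_{t,i_t}}{p_{t,i_t}}\,e_{i_t}$. Its expected regret is $$\mathbb E\,\mathrm{Regret}_T=\mathbb E\Big[\max_{1\le i\le N}\sum_{t=1}^T (g_{t,i}-g_{t,i_t})\Big],$$ the expectation being over the learner's random choices. **Gaussian perturbation.** For $T>4$ let $$\alpha=\frac1{\log T},\qquad \eta=\left(\frac{4NT}{\alpha(1-\alpha)\sqrt{2\log N}}\right)^{1/(2-\alpha)},\qquad \tilde\Phi_{N,T}(G)=\mathbb E\Big[\max_{1\le i\le N}(G_i+\eta Z_i)\Big],$$ where $Z_1,\dots,Z_N$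 are independent standard Gaussian random variables. **Theorem (Regret bound for Gaussian).** For all integers $N\ge2$ and $T>4$, one has $\eta>0$; the function $\tilde\Phi_{N,T}$ is differentiable and convex with gradient in $\Delta^N$; and $\partial_i\tilde\Phi_{N,T}(G)=\mathbb P\big(G_i+\eta Z_i>G_j+\eta Z_j\text{ for all }j\ne i\big)$ for every $G\in\mathbb R^N$ and every $i$, so that GBPA$(\tilde\Phi_{N,T})$ samples its arm as Follow the Perturbed Leader does. For all gain vectors $g_1,\dots,g_T\in[-1,0]^N$ the expected regret of GBPA$(\tilde\Phi_{N,T})$ satisfies $$\mathbb E\,\mathrm{Regret}_T\le 96\sqrt{NT}\;N^{1/\log T}\,\sqrt{\log N}\,\log T .$$ If moreover $T>N$, then $$\mathbb E\,\mathrm{Regret}_T\le 278\sqrt{NT}\,\sqrt{\log N}\,\log T .$$ In particular Gaussian perturbations do not force linear regret: for fixed $N\ge2$ and every $\varepsilon>0$, for all sufficiently large $T$ the expected regret of GBPA$(\tilde\Phi_{N,T})$ is at most $\varepsilon T$ for all gain vectors $g_1,\dots,g_T\in[-1,0]^N$. -/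

import Mathlib

open MeasureTheory ProbabilityTheory Filter

/-- The non-smooth potential `Φ(G) = max_i G_i`. -/
noncomputable def maxPotential {N : ℕ} (G : Fin N → ℝ) : ℝ :=
  ⨆ i, G i

/-- The law of `N` independent standard Gaussian random variables. -/
noncomputable def gaussianVector (N : ℕ) : Measure (Fin N → ℝ) :=
  Measure.pi fun _ => gaussianReal 0 1

/-- The stochastically smoothed potential `G ↦ E[max_i (G_i + η Z_i)]`, with `Z_1, …, Z_N`
independent standard Gaussians. -/
noncomputable def gaussianPotential (N : ℕ) (η : ℝ) (G : Fin N → ℝ) : ℝ :=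
  ∫ z, maxPotential (G + η • z) ∂(gaussianVector N)

/-- The gradient of a potential, as the vector of its partial derivatives; in GBPA it is the
distribution from which the next arm is drawn. -/
noncomputable def potentialGradient {N : ℕ} (Φ : (Fin N → ℝ) → ℝ) (G : Fin N → ℝ) : Fin N → ℝ :=
  fun i => fderiv ℝ Φ G (Pi.single i 1)

/-- The requirement on a potential used in GBPA: it is a differentiable convex function whose
gradient always lies in the probability simplex. -/
structure IsGBPAPotential {N : ℕ} (Φ : (Fin N → ℝ) → ℝ) : Prop where
  differentiable : Differentiable ℝ Φ
  convex : ConvexOn ℝ Set.univ Φ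
  gradient_mem : ∀ G, potentialGradient Φ G ∈ stdSimplex ℝ (Fin N)

/-- GBPA with potential `Φ` against the gain vectors `g 0, g 1, …`: the estimate of the cumulative
gain vector after the first `t` rounds, when the arms played in these rounds are
`a 0, …, a (t - 1)`. It starts at `0`; a round in which arm `k` is drawn from the distribution
`p = ∇Φ(L)` adds the vector `(g_k / p_k) e_k` to the current estimate `L`. -/
noncomputable def gbpaEstimate {N : ℕ} (Φ : (Fin N → ℝ) → ℝ) (g : ℕ → Fin N → ℝ) :
    (t : ℕ) → (Fin t → Fin N) → Fin N → ℝ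
  | 0, _ => 0
  | t + 1, a =>
      gbpaEstimate Φ g t (Fin.init a) +
        Pi.single (a (Fin.last t))
          (g t (a (Fin.last t)) /
            potentialGradient Φ (gbpaEstimate Φ g t (Fin.init a)) (a (Fin.last t)))

/-- The probability that GBPA plays the arms `a 0, …, a (t - 1)` in its first `t` rounds: given
the past, the next arm is drawn from the gradient of `Φ` at the current estimate. -/
noncomputable def gbpaProb {N : ℕ} (Φ : (Fin N → ℝ) → ℝ) (g : ℕ → Fin N → ℝ) :
    (t : ℕ) → (Fin t → Fin N) → ℝ
  | 0, _ => 1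
  | t + 1, a =>
      gbpaProb Φ g t (Fin.init a) *
        potentialGradient Φ (gbpaEstimate Φ g t (Fin.init a)) (a (Fin.last t))

/-- The realized regret `max_i ∑_t (g_{t,i} - g_{t,a_t})` of the sequence of arms `a`. -/
noncomputable def regret {N : ℕ} (g : ℕ → Fin N → ℝ) (T : ℕ) (a : Fin T → Fin N) : ℝ :=
  ⨆ i, ∑ t : Fin T, (g t i - g t (a t))

/-- The expected regret of GBPA with potential `Φ` over `T` rounds; the expectation is over the
learner's random choice of arms. -/
noncomputable def gbpaExpectedRegret {N : ℕ} (Φ : (Fin N → ℝ) → ℝ) (g : ℕ → Fin N → ℝ)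
    (T : ℕ) : ℝ :=
  ∑ a : Fin T → Fin N, gbpaProb Φ g T a * regret g T a

/-- The scale `(4NT / (α (1 - α) √(2 log N)))^(1 / (2 - α))`. -/
noncomputable def gaussianScale (N T : ℕ) (α : ℝ) : ℝ :=
  (4 * N * T / (α * (1 - α) * √(2 * Real.log N))) ^ (1 / (2 - α))

/-- The Gaussian potential for `N` arms and horizon `T`, scaled with `α = 1 / log T`. -/
noncomputable def tunedGaussianPotential (N T : ℕ) : (Fin N → ℝ) → ℝ :=
  gaussianPotential N (gaussianScale N T (1 / Real.log T))

/-!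
Why the bound holds. GBPA's importance-weighted estimate of the cumulative gains is unbiased, so by
Jensen's inequality the expected maximum of the final estimate is at least the gain of the best arm.
For any potential `Φ ≥ max` this gives (`gbpaExpectedRegret_le`) a regret of at most `Φ 0` plus the
sum over the rounds of the mean excess of `Φ` over its linearization.

For the Gaussian potential `Φ G = E max (G + η Z)` ties have probability zero, so `Φ` is
differentiable with gradient the law of the leader (`hasFDerivAt_gaussianPotential`). With
`Φ 0 ≤ η √(2 log N)` it remains to bound the excess in one round. If arm `i`, of probability `p`, is
played and its score drops by `c ≤ 1 / p`, the excess is at most `c (p - p')`, where `p'` is the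
probability that `i` leads afterwards. Conditionally on the other perturbations, `p` is a Gaussian
tail `P(Z > m)` and `p'` is `P(Z > m + c / η)`. The Gaussian hazard rate is unbounded, but it grows
only linearly while the tail decays exponentially; hence the generalized hazard bound
`P(Z > m) - P(Z > m + δ) ≤ (4 / α) δ^(1-α) P(Z > m)^(1-α)` for `0 < α < 1`
(`gaussianTail_sub_le`). Averaging by Jensen gives `p - p' ≤ (4 / α) (c p / η)^(1-α)`
(`gaussianVector_real_leaderSet_sub_le`), so with `c p ≤ 1` each arm contributes at most
`(4 / α) η^(α-1)` to the mean excess of the round (`gaussianPotential_round_le`).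

The regret is therefore at most `η √(2 log N) + (4 / α) N T η^(α-1)`. The chosen scale makes the
second term no larger than the first, and `α = 1 / log T` turns `T^α` into the constant `e`, leaving
`1 / α = log T` as the only loss.
-/

/-! ### The tail of the standard Gaussian -/

/-- The tail function `a ↦ P(Z > a)` of a standard Gaussian `Z`. -/
noncomputable def gaussianTail (a : ℝ) : ℝ :=
  (gaussianReal 0 1).real (Set.Ioi a)

lemma gaussianTail_nonneg (a : ℝ) : 0 ≤ gaussianTail a := measureReal_nonneg

lemma gaussianTail_le_one (a : ℝ) : gaussianTail a ≤ 1 := measureReal_le_one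

lemma gaussianTail_antitone : Antitone gaussianTail := fun _ _ h =>
  measureReal_mono (Set.Ioi_subset_Ioi h)

lemma gaussianTail_sub {a b : ℝ} (h : a ≤ b) :
    gaussianTail a - gaussianTail b = ∫ x in Set.Ioc a b, gaussianPDFReal 0 1 x := by
  have h1 : (gaussianReal 0 1).real (Set.Ioc a b) = ∫ x in Set.Ioc a b, gaussianPDFReal 0 1 x := by
    rw [measureReal_def, gaussianReal_apply_eq_integral 0 one_ne_zero,
      ENNReal.toReal_ofReal (integral_nonneg fun x => gaussianPDFReal_nonneg 0 1 x)]
  rw [← h1, gaussianTail, gaussianTail, ← Set.Ioc_union_Ioi_eq_Ioi h,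
    measureReal_union (Set.Ioc_disjoint_Ioi le_rfl) measurableSet_Ioi]
  ring

lemma gaussianPDFReal_standard (x : ℝ) :
    gaussianPDFReal 0 1 x = (√(2 * Real.pi))⁻¹ * Real.exp (-x ^ 2 / 2) := by
  simp [gaussianPDFReal]

lemma gaussianPDFReal_le_of_abs_le {x y : ℝ} (h : |x| ≤ |y|) :
    gaussianPDFReal 0 1 y ≤ gaussianPDFReal 0 1 x := by
  rw [gaussianPDFReal_standard, gaussianPDFReal_standard]
  have := sq_le_sq.2 h
  gcongr

lemma mul_gaussianPDFReal_le_gaussianTail {a w : ℝ} (ha : 0 ≤ a) (hw : 0 ≤ w) :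
    w * gaussianPDFReal 0 1 (a + w) ≤ gaussianTail a := by
  have h1 := gaussianTail_sub (a := a) (b := a + w) (by linarith)
  have h2 : gaussianPDFReal 0 1 (a + w) * volume.real (Set.Ioc a (a + w)) ≤
      ∫ x in Set.Ioc a (a + w), gaussianPDFReal 0 1 x := by
    refine setIntegral_ge_of_const_le_real measurableSet_Ioc (by simp) (fun x hx => ?_)
      (integrable_gaussianPDFReal 0 1).integrableOn
    apply gaussianPDFReal_le_of_abs_le
    rw [abs_of_nonneg (by linarith [hx.1]), abs_of_nonneg (by linarith)]
    exact hx.2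
  rw [Real.volume_real_Ioc_of_le (by linarith)] at h2
  have := gaussianTail_nonneg (a + w)
  nlinarith

/-- A Mills ratio bound with a non-optimal constant: on `[a, ∞)` the density is at most
`e (1 + a⁺) P(Z > a)`. -/
lemma gaussianPDFReal_le_gaussianTail {a x : ℝ} (h : a ≤ x) :
    gaussianPDFReal 0 1 x ≤ Real.exp 1 * (1 + max a 0) * gaussianTail a := by
  set b := max a 0 with hb
  have hb0 : 0 ≤ b := le_max_right _ _
  have h1 : gaussianPDFReal 0 1 b * Real.exp (-1) ≤ gaussianPDFReal 0 1 (b + (1 + b)⁻¹) := by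
    rw [gaussianPDFReal_standard, gaussianPDFReal_standard, mul_assoc, ← Real.exp_add]
    gcongr
    have h2 : b * (1 + b)⁻¹ + (1 + b)⁻¹ = 1 := by field_simp; ring
    have h3 : 0 < (1 + b)⁻¹ := by positivity
    have h4 : (1 + b)⁻¹ ≤ 1 := inv_le_one_of_one_le₀ (by linarith)
    nlinarith
  have h2 : gaussianPDFReal 0 1 x ≤ gaussianPDFReal 0 1 b := by
    apply gaussianPDFReal_le_of_abs_le
    rw [abs_of_nonneg hb0]
    exact max_le (h.trans (le_abs_self x)) (abs_nonneg x)
  have h3 := mul_gaussianPDFReal_le_gaussianTail hb0 (w := (1 + b)⁻¹) (by positivity)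
  have h4 : gaussianTail b ≤ gaussianTail a := gaussianTail_antitone (le_max_left _ _)
  calc gaussianPDFReal 0 1 x ≤ gaussianPDFReal 0 1 b := h2
    _ = Real.exp 1 * (gaussianPDFReal 0 1 b * Real.exp (-1)) := by
      rw [mul_comm, mul_assoc, ← Real.exp_add]; simp
    _ ≤ Real.exp 1 * gaussianPDFReal 0 1 (b + (1 + b)⁻¹) := by gcongr
    _ = Real.exp 1 * (1 + b) * ((1 + b)⁻¹ * gaussianPDFReal 0 1 (b + (1 + b)⁻¹)) := by
      field_simp
    _ ≤ Real.exp 1 * (1 + b) * gaussianTail a := by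
      gcongr
      exact h3.trans h4

lemma gaussianTail_pos (a : ℝ) : 0 < gaussianTail a := by
  have h1 := gaussianPDFReal_le_gaussianTail (le_refl a)
  have h2 := gaussianPDFReal_pos 0 1 a one_ne_zero
  have h3 : 0 < Real.exp 1 * (1 + max a 0) :=
    mul_pos (Real.exp_pos _) (by linarith [le_max_right a 0])
  exact pos_of_mul_pos_right (h2.trans_le h1) h3.le

/-- An exponential Chernoff bound; the Gaussian decay of the tail is not needed. -/
lemma gaussianTail_le_exp (a : ℝ) : gaussianTail a ≤ Real.exp (1 / 2 - max a 0) := by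
  rcases le_total a 0 with h | h
  · rw [max_eq_right h]
    exact (gaussianTail_le_one a).trans (Real.one_le_exp (by norm_num))
  · rw [max_eq_left h]
    have h1 := measure_ge_le_exp_mul_mgf (μ := gaussianReal 0 1) (X := id) a zero_le_one
      (integrable_exp_mul_gaussianReal 1)
    rw [mgf_id_gaussianReal] at h1
    refine (measureReal_mono fun x hx => ?_).trans (h1.trans ?_)
    · exact (show a < x from hx).le
    · rw [← Real.exp_add]
      apply Real.exp_le_exp.2
      norm_num

lemma gaussianTail_sub_le_mul {a δ : ℝ} (hδ : 0 ≤ δ) :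
    gaussianTail a - gaussianTail (a + δ) ≤
      δ * (Real.exp 1 * (1 + max a 0) * gaussianTail a) := by
  rw [gaussianTail_sub (by linarith)]
  calc ∫ x in Set.Ioc a (a + δ), gaussianPDFReal 0 1 x
      ≤ ∫ x in Set.Ioc a (a + δ), Real.exp 1 * (1 + max a 0) * gaussianTail a :=
        setIntegral_mono_on (integrable_gaussianPDFReal 0 1).integrableOn
          (integrableOn_const (by simp)) measurableSet_Ioc
          fun x hx => gaussianPDFReal_le_gaussianTail hx.1.le
    _ = δ * (Real.exp 1 * (1 + max a 0) * gaussianTail a) := by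
      rw [setIntegral_const, Real.volume_real_Ioc_of_le (by linarith), smul_eq_mul]
      ring

/-- Generalized hazard bound: the decrement of the tail over a step `δ` is of order
`δ^(1-α)` times the `(1-α)`-th power of the tail. Although the Gaussian hazard rate is unbounded,
its growth is absorbed by the spare factor `P(Z > a)^α`, at the price of `1 / α`. -/
lemma gaussianTail_sub_le {α δ : ℝ} (hα0 : 0 < α) (hα1 : α < 1) (hδ : 0 ≤ δ) (a : ℝ) :
    gaussianTail a - gaussianTail (a + δ) ≤ 4 / α * (δ ^ (1 - α) * gaussianTail a ^ (1 - α)) := by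
  set q := gaussianTail a with hq
  set b := max a 0
  have hb : 0 ≤ b := le_max_right _ _
  have hq0 : 0 < q := gaussianTail_pos a
  have hd0 : 0 ≤ q - gaussianTail (a + δ) :=
    sub_nonneg.2 (gaussianTail_antitone (by linarith))
  have hd1 : q - gaussianTail (a + δ) ≤ q := by linarith [gaussianTail_nonneg (a + δ)]
  have hd2 := gaussianTail_sub_le_mul (a := a) hδ
  set d := q - gaussianTail (a + δ)
  have hα : 0 ≤ 1 - α := by linarith
  -- the spare factor: `q ^ α ≤ exp (α / 2 - α b)` beats `1 + b` up to `1 / α`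
  have h1 : q ^ α * (Real.exp 1 * (1 + b)) ^ (1 - α) ≤ 4 / α := by
    have e1 : q ^ α ≤ Real.exp (α / 2 - α * b) := by
      calc q ^ α ≤ (Real.exp (1 / 2 - b)) ^ α := by
            gcongr
            exact gaussianTail_le_exp a
        _ = Real.exp (α / 2 - α * b) := by rw [← Real.exp_mul]; congr 1; ring
    have e2 : (Real.exp 1 * (1 + b)) ^ (1 - α) ≤ Real.exp (1 - α) * (1 + b) := by
      rw [Real.mul_rpow (Real.exp_pos 1).le (by linarith), ← Real.exp_mul, one_mul]
      gcongr
      calc (1 + b) ^ (1 - α) ≤ (1 + b) ^ (1 : ℝ) :=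
            Real.rpow_le_rpow_of_exponent_le (by linarith) (by linarith)
        _ = 1 + b := Real.rpow_one _
    have e3 : 1 + b ≤ Real.exp (α * b) / α := by
      rw [le_div_iff₀ hα0]
      nlinarith [Real.add_one_le_exp (α * b)]
    calc q ^ α * (Real.exp 1 * (1 + b)) ^ (1 - α)
        ≤ Real.exp (α / 2 - α * b) * (Real.exp (1 - α) * (Real.exp (α * b) / α)) := by
          gcongr
          exact e2.trans (by gcongr)
      _ = Real.exp (1 - α / 2) / α := by
          rw [mul_div_assoc', mul_div_assoc', ← Real.exp_add, ← Real.exp_add]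
          congr 2
          ring
      _ ≤ 4 / α := by
          gcongr
          calc Real.exp (1 - α / 2) ≤ Real.exp 1 := Real.exp_le_exp.2 (by linarith)
            _ ≤ 4 := by linarith [Real.exp_one_lt_d9]
  -- the geometric mean, with exponents `α` and `1 - α`, of the two bounds on `d`
  calc d = d ^ α * d ^ (1 - α) := by
        rcases hd0.eq_or_lt with h | h
        · rw [← h, Real.zero_rpow hα0.ne']; simp
        · rw [← Real.rpow_add h]; simp
    _ ≤ q ^ α * (δ * (Real.exp 1 * (1 + b) * q)) ^ (1 - α) := by gcongr
    _ = q ^ α * (Real.exp 1 * (1 + b)) ^ (1 - α) * (δ ^ (1 - α) * q ^ (1 - α)) := by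
        rw [Real.mul_rpow hδ (by positivity), Real.mul_rpow (by positivity) hq0.le]
        ring
    _ ≤ 4 / α * (δ ^ (1 - α) * q ^ (1 - α)) := by gcongr

/-! ### The maximum of finitely many coordinates -/

section maxPotential

variable {N : ℕ}

lemma le_maxPotential (G : Fin N → ℝ) (i : Fin N) : G i ≤ maxPotential G :=
  le_ciSup (Set.finite_range G).bddAbove i

lemma maxPotential_le [NeZero N] {G : Fin N → ℝ} {c : ℝ} (h : ∀ i, G i ≤ c) :
    maxPotential G ≤ c :=
  ciSup_le h

lemma exists_eq_maxPotential [NeZero N] (G : Fin N → ℝ) : ∃ i, G i = maxPotential G :=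
  exists_eq_ciSup_of_finite

lemma lipschitzWith_maxPotential [NeZero N] :
    LipschitzWith 1 (maxPotential : (Fin N → ℝ) → ℝ) := by
  refine LipschitzWith.of_le_add fun G H => maxPotential_le fun i => ?_
  have h1 := (abs_le.1 ((Real.dist_eq _ _).symm.le.trans (dist_le_pi_dist G H i))).2
  linarith [le_maxPotential H i]

lemma maxPotential_eq_of_forall_lt {G : Fin N → ℝ} {i : Fin N} (h : ∀ j, j ≠ i → G j < G i) :
    maxPotential G = G i := by
  have : NeZero N := ⟨by rintro rfl; exact i.elim0⟩
  refine le_antisymm (maxPotential_le fun j => ?_) (le_maxPotential G i)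
  rcases eq_or_ne j i with rfl | hj
  · exact le_rfl
  · exact (h j hj).le

lemma hasFDerivAt_maxPotential {G : Fin N → ℝ} {i : Fin N} (h : ∀ j, j ≠ i → G j < G i) :
    HasFDerivAt maxPotential (ContinuousLinearMap.proj i : (Fin N → ℝ) →L[ℝ] ℝ) G := by
  refine (ContinuousLinearMap.proj i : (Fin N → ℝ) →L[ℝ] ℝ).hasFDerivAt.congr_of_eventuallyEq ?_
  have h1 : ∀ᶠ H : Fin N → ℝ in nhds G, ∀ j, j ≠ i → H j < H i := by
    rw [eventually_all]
    intro j
    by_cases hj : j = i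
    · simp [hj]
    · filter_upwards [(continuous_apply j).continuousAt.eventually_lt
        (continuous_apply i).continuousAt (h j hj)] with H hH _ using hH
  filter_upwards [h1] with H hH using maxPotential_eq_of_forall_lt hH

lemma convexOn_maxPotential [NeZero N] :
    ConvexOn ℝ Set.univ (maxPotential : (Fin N → ℝ) → ℝ) := by
  refine ⟨convex_univ, fun G _ H _ a b ha hb _ => maxPotential_le fun i => ?_⟩
  simp only [Pi.add_apply, Pi.smul_apply, smul_eq_mul]
  gcongr
  exacts [le_maxPotential G i, le_maxPotential H i]

end maxPotential

/-! ### Conditioning a Gaussian vector on all but one coordinate -/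

instance (N : ℕ) : IsProbabilityMeasure (gaussianVector N) := by
  unfold gaussianVector; infer_instance

lemma integral_gaussianVector_eval {N : ℕ} (i : Fin N) (f : ℝ → ℝ) (hf : Continuous f) :
    ∫ z, f (z i) ∂(gaussianVector N) = ∫ x, f x ∂(gaussianReal 0 1) :=
  integral_comp_eval (μ := fun _ : Fin N => gaussianReal 0 1) hf.aestronglyMeasurable

lemma integrable_gaussianVector_eval {N : ℕ} (i : Fin N) :
    Integrable (fun z : Fin N → ℝ => z i) (gaussianVector N) :=
  integrable_comp_eval (μ := fun _ : Fin N => gaussianReal 0 1) (f := id)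
    ((memLp_id_gaussianReal 1).integrable le_rfl)

lemma gaussianVector_succ_apply {n : ℕ} (i : Fin (n + 1)) {s : Set (ℝ × (Fin n → ℝ))}
    (hs : MeasurableSet s) :
    gaussianVector (n + 1) {z | (z i, fun k => z (i.succAbove k)) ∈ s} =
      ∫⁻ w, gaussianReal 0 1 {x | (x, w) ∈ s} ∂(gaussianVector n) := by
  have h := measurePreserving_piFinSuccAbove (fun _ : Fin (n + 1) => gaussianReal 0 1) i
  exact (h.measure_preimage hs.nullMeasurableSet).trans (Measure.prod_apply_symm hs)

lemma gaussianVector_tie_null {N : ℕ} {η : ℝ} (hη : 0 < η) (G : Fin N → ℝ) {i j : Fin N}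
    (hij : j ≠ i) : gaussianVector N {z | G j + η * z j = G i + η * z i} = 0 := by
  obtain _ | n := N
  · exact i.elim0
  obtain ⟨k, rfl⟩ := Fin.exists_succAbove_eq hij
  have hs : MeasurableSet {p : ℝ × (Fin n → ℝ) | G (i.succAbove k) + η * p.2 k =
      G i + η * p.1} := measurableSet_eq_fun (by fun_prop) (by fun_prop)
  refine (gaussianVector_succ_apply i hs).trans ?_
  have h : ∀ w : Fin n → ℝ, gaussianReal 0 1 {x | (x, w) ∈ {p : ℝ × (Fin n → ℝ) |
      G (i.succAbove k) + η * p.2 k = G i + η * p.1}} = 0 := by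
    intro w
    have := nullSingletonClass_gaussianReal (μ := 0) (v := 1) one_ne_zero
    refine (Set.Subsingleton.measure_zero ?_ _)
    intro x hx y hy
    simp only [Set.mem_ofPred_eq] at hx hy
    exact mul_left_cancel₀ hη.ne' (by linarith)
  exact (lintegral_congr h).trans lintegral_zero

/-! ### The leader under Gaussian perturbation -/

/-- The perturbations for which `i` is the unique leader of `G + η z`. -/
def leaderSet {N : ℕ} (η : ℝ) (G : Fin N → ℝ) (i : Fin N) : Set (Fin N → ℝ) :=
  {z | ∀ j, j ≠ i → G j + η * z j < G i + η * z i}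

/-- The value of `z i` above which `i` leads `G + η z`, given the other coordinates `w` of `z`. -/
noncomputable def leaderThreshold {n : ℕ} (η : ℝ) (G : Fin (n + 1) → ℝ) (i : Fin (n + 1))
    (w : Fin n → ℝ) : ℝ :=
  (maxPotential (fun k => G (i.succAbove k) + η * w k) - G i) / η

lemma measurableSet_leaderSet {N : ℕ} (η : ℝ) (G : Fin N → ℝ) (i : Fin N) :
    MeasurableSet (leaderSet η G i) := by
  have : leaderSet η G i = ⋂ j, ⋂ (_ : j ≠ i), {z | G j + η * z j < G i + η * z i} := by
    ext z; simp [leaderSet]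
  rw [this]
  exact MeasurableSet.iInter fun j => MeasurableSet.iInter fun _ =>
    measurableSet_lt (by fun_prop) (by fun_prop)

lemma measurable_leaderThreshold {n : ℕ} (η : ℝ) (G : Fin (n + 2) → ℝ) (i : Fin (n + 2)) :
    Measurable (leaderThreshold η G i) := by
  unfold leaderThreshold
  have := (lipschitzWith_maxPotential (N := n + 1)).continuous
  fun_prop

lemma leaderThreshold_sub_single {n : ℕ} (η : ℝ) (G : Fin (n + 1) → ℝ) (i : Fin (n + 1)) (c : ℝ)
    (w : Fin n → ℝ) :
    leaderThreshold η (G - Pi.single i c) i w = leaderThreshold η G i w + c / η := by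
  simp only [leaderThreshold, Pi.sub_apply, Pi.single_eq_same, Fin.succAbove_ne, ne_eq,
    not_false_eq_true, Pi.single_eq_of_ne, sub_zero]
  ring

lemma integrable_gaussianTail_comp {n : ℕ} {M : (Fin n → ℝ) → ℝ} (hM : Measurable M) :
    Integrable (fun w => gaussianTail (M w)) (gaussianVector n) := by
  refine Integrable.of_bound (gaussianTail_antitone.measurable.comp hM).aestronglyMeasurable 1
    (ae_of_all _ fun w => ?_)
  rw [Real.norm_of_nonneg (gaussianTail_nonneg _)]
  exact gaussianTail_le_one _

/-- The probability of leading, as the average over the other coordinates of the Gaussian tail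
beyond the threshold. -/
lemma gaussianVector_real_leaderSet {n : ℕ} {η : ℝ} (hη : 0 < η) (G : Fin (n + 2) → ℝ)
    (i : Fin (n + 2)) :
    (gaussianVector (n + 2)).real (leaderSet η G i) =
      ∫ w, gaussianTail (leaderThreshold η G i w) ∂(gaussianVector (n + 1)) := by
  have hM := measurable_leaderThreshold η G i
  have hs : MeasurableSet {p : ℝ × (Fin (n + 1) → ℝ) | leaderThreshold η G i p.2 < p.1} :=
    measurableSet_lt (by fun_prop) (by fun_prop)
  have h1 : leaderSet η G i = {z | (z i, fun k => z (i.succAbove k)) ∈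
      {p : ℝ × (Fin (n + 1) → ℝ) | leaderThreshold η G i p.2 < p.1}} := by
    ext z
    simp only [leaderSet, leaderThreshold, Set.mem_ofPred_eq]
    rw [div_lt_iff₀ hη, sub_lt_iff_lt_add']
    constructor
    · intro h
      obtain ⟨k, hk⟩ := exists_eq_maxPotential
        (fun k => G (i.succAbove k) + η * z (i.succAbove k))
      rw [← hk, mul_comm (z i)]
      exact h _ (Fin.succAbove_ne i k)
    · intro h j hj
      obtain ⟨k, rfl⟩ := Fin.exists_succAbove_eq hj
      have := le_maxPotential (fun k => G (i.succAbove k) + η * z (i.succAbove k)) k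
      linarith
  rw [h1, measureReal_def, gaussianVector_succ_apply i hs, integral_eq_lintegral_of_nonneg_ae
    (ae_of_all _ fun w => gaussianTail_nonneg _) (integrable_gaussianTail_comp hM).1]
  congr 2
  ext w
  exact (ofReal_measureReal (μ := gaussianReal 0 1)
    (s := Set.Ioi (leaderThreshold η G i w))).symm

lemma gaussianVector_real_leaderSet_pos {n : ℕ} {η : ℝ} (hη : 0 < η) (G : Fin (n + 2) → ℝ)
    (i : Fin (n + 2)) : 0 < (gaussianVector (n + 2)).real (leaderSet η G i) := by
  rw [gaussianVector_real_leaderSet hη, integral_pos_iff_support_of_nonneg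
    (fun w => gaussianTail_nonneg _)
    (integrable_gaussianTail_comp (measurable_leaderThreshold η G i))]
  have : (Function.support fun w => gaussianTail (leaderThreshold η G i w)) = Set.univ :=
    Set.eq_univ_of_forall fun w => (gaussianTail_pos _).ne'
  simp [this]

/-- The probability of leading loses at most order `(c p / η)^(1-α)` when the leader's score is
lowered by `c`: the generalized hazard bound, averaged with Jensen's inequality. -/
lemma gaussianVector_real_leaderSet_sub_le {n : ℕ} {η α c : ℝ} (hη : 0 < η) (hα0 : 0 < α)
    (hα1 : α < 1) (hc : 0 ≤ c) (G : Fin (n + 2) → ℝ) (i : Fin (n + 2)) :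
    (gaussianVector (n + 2)).real (leaderSet η G i) -
        (gaussianVector (n + 2)).real (leaderSet η (G - Pi.single i c) i) ≤
      4 / α * ((c / η) ^ (1 - α) * (gaussianVector (n + 2)).real (leaderSet η G i) ^ (1 - α)) := by
  have hM := measurable_leaderThreshold η G i
  have hI := integrable_gaussianTail_comp hM
  have hα : 0 ≤ 1 - α := by linarith
  rw [gaussianVector_real_leaderSet hη, gaussianVector_real_leaderSet hη]
  simp only [leaderThreshold_sub_single]
  have hI2 := integrable_gaussianTail_comp (hM.add_const (c / η))
  have hI3 : Integrable (fun w => gaussianTail (leaderThreshold η G i w) ^ (1 - α))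
      (gaussianVector (n + 1)) := by
    refine Integrable.of_bound (hI.1.aemeasurable.pow_const _).aestronglyMeasurable 1
      (ae_of_all _ fun w => ?_)
    rw [Real.norm_of_nonneg (Real.rpow_nonneg (gaussianTail_nonneg _) _)]
    exact Real.rpow_le_one (gaussianTail_nonneg _) (gaussianTail_le_one _) hα
  rw [← integral_sub hI hI2]
  calc ∫ w, (gaussianTail (leaderThreshold η G i w) -
          gaussianTail (leaderThreshold η G i w + c / η)) ∂(gaussianVector (n + 1))
      ≤ ∫ w, 4 / α * ((c / η) ^ (1 - α) * gaussianTail (leaderThreshold η G i w) ^ (1 - α))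
          ∂(gaussianVector (n + 1)) :=
        integral_mono (hI.sub hI2) ((hI3.const_mul _).const_mul _)
          fun w => gaussianTail_sub_le hα0 hα1 (by positivity) _
    _ = 4 / α * ((c / η) ^ (1 - α) * ∫ w, gaussianTail (leaderThreshold η G i w) ^ (1 - α)
          ∂(gaussianVector (n + 1))) := by
        rw [integral_const_mul, integral_const_mul]
    _ ≤ _ := by
        gcongr
        exact (Real.concaveOn_rpow hα (by linarith)).le_map_integral
          (Real.continuous_rpow_const hα).continuousOn isClosed_Ici
          (ae_of_all _ fun w => gaussianTail_nonneg _) hI hI3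

/-! ### Differentiability and convexity of the smoothed potential -/

section gaussianPotential

variable {N : ℕ} {η : ℝ}

lemma integrable_maxPotential [NeZero N] (η : ℝ) (G : Fin N → ℝ) :
    Integrable (fun z => maxPotential (G + η • z)) (gaussianVector N) := by
  have hc : Continuous fun z : Fin N → ℝ => maxPotential (G + η • z) :=
    lipschitzWith_maxPotential.continuous.comp (by fun_prop)
  have hb : Integrable (fun z : Fin N → ℝ => ∑ i, |G i + η * z i|) (gaussianVector N) :=
    integrable_finsetSum _ fun i _ =>
      ((integrable_const _).add ((integrable_gaussianVector_eval i).const_mul η)).abs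
  refine hb.mono' hc.aestronglyMeasurable (ae_of_all _ fun z => ?_)
  obtain ⟨i, hi⟩ := exists_eq_maxPotential (G + η • z)
  rw [← hi]
  exact Finset.single_le_sum (f := fun i => |G i + η * z i|) (fun i _ => abs_nonneg _)
    (Finset.mem_univ i)

lemma maxPotential_le_gaussianPotential [NeZero N] (η : ℝ) (G : Fin N → ℝ) :
    maxPotential G ≤ gaussianPotential N η G := by
  refine maxPotential_le fun i => ?_
  have h0 : ∫ z, z i ∂(gaussianVector N) = 0 :=
    (integral_gaussianVector_eval i (fun x => x) continuous_id).trans integral_id_gaussianReal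
  have hI := (integrable_gaussianVector_eval i).const_mul η
  calc G i = ∫ z, (G i + η * z i) ∂(gaussianVector N) := by
        rw [integral_add (integrable_const _) hI, integral_const_mul, h0]
        simp
    _ ≤ ∫ z, maxPotential (G + η • z) ∂(gaussianVector N) :=
        integral_mono ((integrable_const _).add hI) (integrable_maxPotential η G)
          fun z => le_maxPotential (G + η • z) i

lemma convexOn_gaussianPotential [NeZero N] (η : ℝ) :
    ConvexOn ℝ Set.univ (gaussianPotential N η) := by
  refine ⟨convex_univ, fun G _ H _ a b ha hb hab => ?_⟩
  have hG := integrable_maxPotential η G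
  have hH := integrable_maxPotential η H
  simp only [gaussianPotential, smul_eq_mul]
  rw [← integral_const_mul, ← integral_const_mul, ← integral_add (hG.const_mul a) (hH.const_mul b)]
  refine integral_mono (integrable_maxPotential η _) ((hG.const_mul a).add (hH.const_mul b))
    fun z => ?_
  have h := convexOn_maxPotential.2 (Set.mem_univ (G + η • z)) (Set.mem_univ (H + η • z)) ha hb hab
  have he : a • G + b • H + η • z = a • (G + η • z) + b • (H + η • z) := by
    rw [smul_add, smul_add, add_add_add_comm, ← add_smul, hab, one_smul]
  rw [← he] at h
  exact h

/-- Ties have probability zero, so almost surely some arm leads strictly. -/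
lemma ae_exists_mem_leaderSet [NeZero N] (hη : 0 < η) (G : Fin N → ℝ) :
    ∀ᵐ z ∂(gaussianVector N), ∃ i, z ∈ leaderSet η G i := by
  have h : ∀ᵐ z ∂(gaussianVector N), ∀ i j, j ≠ i → G j + η * z j ≠ G i + η * z i := by
    rw [ae_all_iff]
    intro i
    rw [ae_all_iff]
    intro j
    by_cases hij : j = i
    · simp [hij]
    · have h0 := gaussianVector_tie_null hη G hij
      filter_upwards [measure_eq_zero_iff_ae_notMem.1 h0] with z hz _ using hz
  filter_upwards [h] with z hz
  obtain ⟨i, hi⟩ := exists_eq_maxPotential (G + η • z)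
  refine ⟨i, fun j hj => lt_of_le_of_ne ?_ (hz i j hj)⟩
  have := le_maxPotential (G + η • z) j
  rwa [← hi] at this

lemma sum_indicator_leaderSet_smul {E : Type*} [AddCommGroup E] [Module ℝ E] {G z : Fin N → ℝ}
    {i : Fin N} (hz : z ∈ leaderSet η G i) (f : Fin N → E) :
    ∑ k, (leaderSet η G k).indicator (fun _ => (1 : ℝ)) z • f k = f i := by
  rw [Finset.sum_eq_single i, Set.indicator_of_mem hz, one_smul]
  · intro k _ hk
    rw [Set.indicator_of_notMem (fun hz' : z ∈ leaderSet η G k =>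
      lt_asymm (hz k hk) (hz' i hk.symm)), zero_smul]
  · simp

lemma integrable_indicator_leaderSet (η : ℝ) (G : Fin N → ℝ) (i : Fin N) :
    Integrable ((leaderSet η G i).indicator fun _ => (1 : ℝ)) (gaussianVector N) :=
  (integrable_const _).indicator (measurableSet_leaderSet η G i)

lemma integral_indicator_leaderSet (η : ℝ) (G : Fin N → ℝ) (i : Fin N) :
    ∫ z, (leaderSet η G i).indicator (fun _ => (1 : ℝ)) z ∂(gaussianVector N) =
      (gaussianVector N).real (leaderSet η G i) := by
  rw [integral_indicator_const _ (measurableSet_leaderSet η G i), smul_eq_mul, mul_one]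

section

variable {E : Type*} [NormedAddCommGroup E] [NormedSpace ℝ E]

lemma integrable_sum_indicator_leaderSet_smul (η : ℝ) (G : Fin N → ℝ) (f : Fin N → E) :
    Integrable (fun z => ∑ i, (leaderSet η G i).indicator (fun _ => (1 : ℝ)) z • f i)
      (gaussianVector N) :=
  integrable_finsetSum _ fun i _ => (integrable_indicator_leaderSet η G i).smul_const _

lemma integral_sum_indicator_leaderSet_smul [CompleteSpace E] (η : ℝ) (G : Fin N → ℝ)
    (f : Fin N → E) :
    ∫ z, ∑ i, (leaderSet η G i).indicator (fun _ => (1 : ℝ)) z • f i ∂(gaussianVector N) =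
      ∑ i, (gaussianVector N).real (leaderSet η G i) • f i := by
  rw [integral_finsetSum _ fun i _ => (integrable_indicator_leaderSet η G i).smul_const _]
  simp only [integral_smul_const, integral_indicator_leaderSet]

end

/-- The gradient of the smoothed potential is the law of the leader: for almost every perturbation
the maximum is locally a single coordinate, and one may differentiate under the expectation since
the maximum is `1`-Lipschitz. -/
lemma hasFDerivAt_gaussianPotential [NeZero N] (hη : 0 < η) (G : Fin N → ℝ) :
    HasFDerivAt (gaussianPotential N η)
      (∑ i, (gaussianVector N).real (leaderSet η G i) •
        (ContinuousLinearMap.proj i : (Fin N → ℝ) →L[ℝ] ℝ)) G := by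
  have hlip : ∀ z : Fin N → ℝ,
      LipschitzOnWith (Real.nnabs 1) (fun G => maxPotential (G + η • z)) Set.univ := by
    intro z
    refine LipschitzWith.lipschitzOnWith (LipschitzWith.of_dist_le_mul fun G H => ?_)
    have h := lipschitzWith_maxPotential.dist_le_mul (G + η • z) (H + η • z)
    simpa using h
  have hdiff : ∀ᵐ z ∂(gaussianVector N), HasFDerivAt (fun G => maxPotential (G + η • z))
      (∑ i, (leaderSet η G i).indicator (fun _ => (1 : ℝ)) z •
        (ContinuousLinearMap.proj i : (Fin N → ℝ) →L[ℝ] ℝ)) G := by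
    filter_upwards [ae_exists_mem_leaderSet hη G] with z ⟨i, hi⟩
    have h := (hasFDerivAt_maxPotential (G := G + η • z) hi).comp G
      ((hasFDerivAt_id G).add_const (η • z))
    have he := sum_indicator_leaderSet_smul hi
      fun k => (ContinuousLinearMap.proj k : (Fin N → ℝ) →L[ℝ] ℝ)
    rw [ContinuousLinearMap.comp_id, ← he] at h
    exact h
  refine HasFDerivAt.congr_fderiv ?_ (integral_sum_indicator_leaderSet_smul η G
    fun i => (ContinuousLinearMap.proj i : (Fin N → ℝ) →L[ℝ] ℝ))
  exact (hasFDerivAt_integral_of_dominated_loc_of_lip univ_mem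
    (Eventually.of_forall fun H => (integrable_maxPotential η H).1)
    (integrable_maxPotential η G) (integrable_sum_indicator_leaderSet_smul η G _).1
    (ae_of_all _ hlip) (integrable_const (1 : ℝ)) hdiff).2

lemma potentialGradient_gaussianPotential [NeZero N] (hη : 0 < η) (G : Fin N → ℝ) (i : Fin N) :
    potentialGradient (gaussianPotential N η) G i =
      (gaussianVector N).real (leaderSet η G i) := by
  rw [potentialGradient, (hasFDerivAt_gaussianPotential hη G).fderiv]
  simp [Pi.single_apply]

lemma sum_gaussianVector_real_leaderSet [NeZero N] (hη : 0 < η) (G : Fin N → ℝ) :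
    ∑ i, (gaussianVector N).real (leaderSet η G i) = 1 := by
  calc ∑ i, (gaussianVector N).real (leaderSet η G i)
      = ∫ z, ∑ i, (leaderSet η G i).indicator (fun _ => (1 : ℝ)) z ∂(gaussianVector N) := by
        rw [integral_finsetSum _ fun i _ => integrable_indicator_leaderSet η G i]
        simp only [integral_indicator_leaderSet]
    _ = ∫ _, (1 : ℝ) ∂(gaussianVector N) := by
        refine integral_congr_ae ?_
        filter_upwards [ae_exists_mem_leaderSet hη G] with z ⟨i, hi⟩
        simpa using sum_indicator_leaderSet_smul hi fun _ => (1 : ℝ)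
    _ = 1 := by simp

lemma isGBPAPotential_gaussianPotential [NeZero N] (hη : 0 < η) :
    IsGBPAPotential (gaussianPotential N η) where
  differentiable G := (hasFDerivAt_gaussianPotential hη G).differentiableAt
  convex := convexOn_gaussianPotential η
  gradient_mem G := by
    refine ⟨fun i => ?_, ?_⟩
    · rw [potentialGradient_gaussianPotential hη]
      exact measureReal_nonneg
    · simp only [potentialGradient_gaussianPotential hη]
      exact sum_gaussianVector_real_leaderSet hη G

/-- The expected maximum of `N` standard Gaussians is at most `√(2 log N)`, by the exponential
moment at `l = √(2 log N)`. -/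
lemma integral_maxPotential_gaussianVector_le (hN : 2 ≤ N) :
    ∫ z, maxPotential z ∂(gaussianVector N) ≤ √(2 * Real.log N) := by
  have : NeZero N := ⟨by omega⟩
  have hN0 : (0 : ℝ) < N := by positivity
  have hlog : 0 < Real.log N := Real.log_pos (by exact_mod_cast hN)
  set l := √(2 * Real.log N) with hl
  have hl0 : 0 < l := Real.sqrt_pos.2 (by linarith)
  have hl2 : l ^ 2 = 2 * Real.log N := Real.sq_sqrt (by linarith)
  have hE : Real.exp (l ^ 2 / 2) = N := by
    rw [hl2, mul_div_cancel_left₀ _ two_ne_zero, Real.exp_log hN0]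
  have hI : ∀ i : Fin N, Integrable (fun z : Fin N → ℝ => Real.exp (l * z i))
      (gaussianVector N) := fun i =>
    integrable_comp_eval (μ := fun _ : Fin N => gaussianReal 0 1)
      (f := fun x => Real.exp (l * x)) (integrable_exp_mul_gaussianReal l)
  have hm : ∀ i : Fin N, ∫ z, Real.exp (l * z i) ∂(gaussianVector N) = N := by
    intro i
    rw [integral_gaussianVector_eval i (fun x => Real.exp (l * x)) (by fun_prop), ← hE]
    have := congrFun (mgf_id_gaussianReal (μ := 0) (v := 1)) l
    simpa [mgf] using this
  -- the tangent line bound `y ≤ exp y - 1` at `y = l m - l²`, where `exp l² = N²`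
  have hpt : ∀ z : Fin N → ℝ, l * maxPotential z ≤
      l ^ 2 - 1 + ((N : ℝ) ^ 2)⁻¹ * ∑ i, Real.exp (l * z i) := by
    intro z
    obtain ⟨i, hi⟩ := exists_eq_maxPotential z
    have h1 : Real.exp (l * z i) ≤ ∑ i, Real.exp (l * z i) :=
      Finset.single_le_sum (f := fun i => Real.exp (l * z i)) (fun i _ => (Real.exp_pos _).le)
        (Finset.mem_univ i)
    have h2 := Real.add_one_le_exp (l * z i - l ^ 2)
    have h3 : Real.exp (l * z i - l ^ 2) = ((N : ℝ) ^ 2)⁻¹ * Real.exp (l * z i) := by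
      rw [Real.exp_sub, ← hE, ← Real.exp_nat_mul, div_eq_inv_mul]
      congr 3
      push_cast
      ring
    have h4 : ((N : ℝ) ^ 2)⁻¹ * Real.exp (l * z i) ≤
        ((N : ℝ) ^ 2)⁻¹ * ∑ i, Real.exp (l * z i) := by gcongr
    rw [← hi]
    linarith
  have hS : Integrable (fun z : Fin N → ℝ => ((N : ℝ) ^ 2)⁻¹ * ∑ i, Real.exp (l * z i))
      (gaussianVector N) := (integrable_finsetSum _ fun i _ => hI i).const_mul _
  have hmax : Integrable (fun z : Fin N → ℝ => maxPotential z) (gaussianVector N) := by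
    simpa using integrable_maxPotential 1 (0 : Fin N → ℝ)
  have h := integral_mono (hmax.const_mul l) ((integrable_const (l ^ 2 - 1)).add hS) hpt
  have hR : ∫ z, (l ^ 2 - 1 + ((N : ℝ) ^ 2)⁻¹ * ∑ i, Real.exp (l * z i)) ∂(gaussianVector N) =
      l ^ 2 := by
    rw [integral_add (integrable_const _) hS, integral_const_mul,
      integral_finsetSum _ fun i _ => hI i]
    simp only [hm]
    simp
    field_simp
    ring
  have h' : l * ∫ z, maxPotential z ∂(gaussianVector N) ≤ l ^ 2 := by
    rw [← integral_const_mul]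
    exact h.trans hR.le
  nlinarith

lemma gaussianPotential_zero_le (hN : 2 ≤ N) (hη : 0 ≤ η) :
    gaussianPotential N η 0 ≤ η * √(2 * Real.log N) := by
  have h : ∀ z : Fin N → ℝ, maxPotential (0 + η • z) = η * maxPotential z := fun z => by
    simp only [maxPotential, zero_add, Pi.smul_apply, smul_eq_mul]
    exact (Real.mul_iSup_of_nonneg hη _).symm
  simp only [gaussianPotential, h]
  rw [integral_const_mul]
  exact mul_le_mul_of_nonneg_left (integral_maxPotential_gaussianVector_le hN) hη

end gaussianPotential

/-! ### The regret of GBPA with a general potential -/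

section GBPA

variable {N : ℕ}

/-- The expectation of a function of the arms played by GBPA in its first `t` rounds. -/
noncomputable def gbpaExpectation (Φ : (Fin N → ℝ) → ℝ) (g : ℕ → Fin N → ℝ) (t : ℕ)
    (h : (Fin t → Fin N) → ℝ) : ℝ :=
  ∑ a, gbpaProb Φ g t a * h a

variable {Φ : (Fin N → ℝ) → ℝ} {g : ℕ → Fin N → ℝ} {t : ℕ}

lemma gbpaExpectation_zero (h : (Fin 0 → Fin N) → ℝ) :
    gbpaExpectation Φ g 0 h = h Fin.elim0 := by
  simp [gbpaExpectation, gbpaProb, Subsingleton.elim (default : Fin 0 → Fin N) Fin.elim0]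

/-- Conditioning the arms of `t + 1` rounds on those of the first `t` rounds. -/
lemma gbpaExpectation_succ (h : (Fin (t + 1) → Fin N) → ℝ) :
    gbpaExpectation Φ g (t + 1) h = gbpaExpectation Φ g t fun a =>
      ∑ k, potentialGradient Φ (gbpaEstimate Φ g t a) k * h (Fin.snoc (α := fun _ => Fin N) a k) := by
  unfold gbpaExpectation
  rw [← (Fin.snocEquiv fun _ => Fin N).sum_comp, Fintype.sum_prod_type, Finset.sum_comm]
  refine Finset.sum_congr rfl fun a _ => ?_
  rw [Finset.mul_sum]
  refine Finset.sum_congr rfl fun k _ => ?_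
  simp only [Fin.snocEquiv, Equiv.coe_fn_mk, gbpaProb, Fin.init_snoc, Fin.snoc_last]
  ring

lemma gbpaEstimate_snoc (a : Fin t → Fin N) (k : Fin N) :
    gbpaEstimate Φ g (t + 1) (Fin.snoc (α := fun _ => Fin N) a k) =
      gbpaEstimate Φ g t a +
        Pi.single k (g t k / potentialGradient Φ (gbpaEstimate Φ g t a) k) := by
  simp only [gbpaEstimate, Fin.init_snoc, Fin.snoc_last]

lemma gbpaExpectation_add (h₁ h₂ : (Fin t → Fin N) → ℝ) :
    gbpaExpectation Φ g t (fun a => h₁ a + h₂ a) =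
      gbpaExpectation Φ g t h₁ + gbpaExpectation Φ g t h₂ := by
  simp [gbpaExpectation, mul_add, Finset.sum_add_distrib]

lemma gbpaExpectation_sub (h₁ h₂ : (Fin t → Fin N) → ℝ) :
    gbpaExpectation Φ g t (fun a => h₁ a - h₂ a) =
      gbpaExpectation Φ g t h₁ - gbpaExpectation Φ g t h₂ := by
  simp [gbpaExpectation, mul_sub, Finset.sum_sub_distrib]

lemma gbpaProb_nonneg (hΦ : IsGBPAPotential Φ) : ∀ (t : ℕ) (a : Fin t → Fin N),
    0 ≤ gbpaProb Φ g t a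
  | 0, _ => zero_le_one
  | t + 1, _ => mul_nonneg (gbpaProb_nonneg hΦ t _) ((hΦ.gradient_mem _).1 _)

lemma gbpaExpectation_mono (hΦ : IsGBPAPotential Φ) {h₁ h₂ : (Fin t → Fin N) → ℝ}
    (h : ∀ a, h₁ a ≤ h₂ a) : gbpaExpectation Φ g t h₁ ≤ gbpaExpectation Φ g t h₂ :=
  Finset.sum_le_sum fun a _ => mul_le_mul_of_nonneg_left (h a) (gbpaProb_nonneg hΦ t a)

lemma gbpaExpectation_const (hΦ : IsGBPAPotential Φ) (c : ℝ) :
    gbpaExpectation Φ g t (fun _ => c) = c := by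
  induction t with
  | zero => exact gbpaExpectation_zero _
  | succ t ih =>
    rw [gbpaExpectation_succ]
    simp only [← Finset.sum_mul, (hΦ.gradient_mem _).2, one_mul]
    exact ih

/-- Importance weighting makes the estimate of the cumulative gains unbiased. -/
lemma gbpaExpectation_gbpaEstimate (hΦ : IsGBPAPotential Φ)
    (hpos : ∀ G i, 0 < potentialGradient Φ G i) (g : ℕ → Fin N → ℝ) (t : ℕ) (i : Fin N) :
    gbpaExpectation Φ g t (fun a => gbpaEstimate Φ g t a i) = ∑ s : Fin t, g s i := by
  induction t with
  | zero => simp [gbpaExpectation_zero, gbpaEstimate]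
  | succ t ih =>
    rw [gbpaExpectation_succ, Fin.sum_univ_castSucc]
    simp only [Fin.val_castSucc, Fin.val_last]
    rw [← ih, ← gbpaExpectation_const (Φ := Φ) (g := g) (t := t) hΦ (g t i),
      ← gbpaExpectation_add]
    congr 1
    ext a
    simp only [gbpaEstimate_snoc, Pi.add_apply, mul_add, Finset.sum_add_distrib, ← Finset.sum_mul,
      (hΦ.gradient_mem _).2, one_mul]
    rw [Finset.sum_eq_single i, Pi.single_eq_same, mul_div_cancel₀ _ (hpos _ i).ne']
    · intro k _ hk
      rw [Pi.single_eq_of_ne hk.symm, mul_zero]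
    · simp

/-- If in each round the conditional mean of the potential grows by at most the mean gain plus `B`,
then the potential of the final estimate is at most `Φ 0` plus the mean total gain plus `t B`. -/
lemma gbpaExpectation_potential_le (hΦ : IsGBPAPotential Φ) {B : ℝ} (t : ℕ)
    (hstep : ∀ s < t, ∀ L, ∑ k, potentialGradient Φ L k *
        Φ (L + Pi.single k (g s k / potentialGradient Φ L k)) ≤
      Φ L + ∑ k, potentialGradient Φ L k * g s k + B) :
    gbpaExpectation Φ g t (fun a => Φ (gbpaEstimate Φ g t a)) ≤
      Φ 0 + gbpaExpectation Φ g t (fun a => ∑ s : Fin t, g s (a s)) + t * B := by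
  induction t with
  | zero => simp [gbpaExpectation_zero, gbpaEstimate]
  | succ t ih =>
    have ih := ih fun s hs => hstep s (hs.trans (Nat.lt_succ_self t))
    have h1 : gbpaExpectation Φ g (t + 1) (fun a => ∑ s : Fin (t + 1), g s (a s)) =
        gbpaExpectation Φ g t (fun a => ∑ s : Fin t, g s (a s)) +
        gbpaExpectation Φ g t
          (fun a => ∑ k, potentialGradient Φ (gbpaEstimate Φ g t a) k * g t k) := by
      rw [gbpaExpectation_succ, ← gbpaExpectation_add]
      congr 1
      ext a
      simp only [Fin.sum_univ_castSucc, Fin.val_castSucc, Fin.snoc_castSucc, Fin.val_last,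
        Fin.snoc_last, mul_add, Finset.sum_add_distrib]
      rw [← Finset.sum_mul, (hΦ.gradient_mem _).2, one_mul]
    have h2 : gbpaExpectation Φ g (t + 1) (fun a => Φ (gbpaEstimate Φ g (t + 1) a)) ≤
        gbpaExpectation Φ g t (fun a => Φ (gbpaEstimate Φ g t a)) +
        gbpaExpectation Φ g t
          (fun a => ∑ k, potentialGradient Φ (gbpaEstimate Φ g t a) k * g t k) + B := by
      rw [gbpaExpectation_succ, ← gbpaExpectation_add,
        ← gbpaExpectation_const (Φ := Φ) (g := g) (t := t) hΦ B, ← gbpaExpectation_add]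
      refine gbpaExpectation_mono hΦ fun a => ?_
      simp only [gbpaEstimate_snoc]
      exact hstep t (Nat.lt_succ_self t) _
    push_cast
    linarith

/-- The regret bound for a potential dominating the maximum. The comparison with the best arm is
Jensen's inequality for the maximum, applied to the unbiased estimate. -/
theorem gbpaExpectedRegret_le [NeZero N] (hΦ : IsGBPAPotential Φ)
    (hpos : ∀ G i, 0 < potentialGradient Φ G i) (hmax : ∀ G, maxPotential G ≤ Φ G) {B : ℝ}
    (T : ℕ) (hstep : ∀ s < T, ∀ L, ∑ k, potentialGradient Φ L k *
        Φ (L + Pi.single k (g s k / potentialGradient Φ L k)) ≤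
      Φ L + ∑ k, potentialGradient Φ L k * g s k + B) :
    gbpaExpectedRegret Φ g T ≤ Φ 0 + T * B := by
  have h1 : ∀ a : Fin T → Fin N, regret g T a =
      maxPotential (fun i => ∑ s : Fin T, g s i) - ∑ s : Fin T, g s (a s) := by
    intro a
    simp only [regret, maxPotential, Finset.sum_sub_distrib]
    exact (ciSup_sub (Set.finite_range _).bddAbove _).symm
  have h2 : gbpaExpectedRegret Φ g T = maxPotential (fun i => ∑ s : Fin T, g s i) -
      gbpaExpectation Φ g T (fun a => ∑ s : Fin T, g s (a s)) := by
    have := gbpaExpectation_sub (Φ := Φ) (g := g)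
      (fun _ : Fin T → Fin N => maxPotential (fun i => ∑ s : Fin T, g s i))
      (fun a => ∑ s : Fin T, g s (a s))
    rw [gbpaExpectation_const hΦ] at this
    rw [← this]
    simp only [gbpaExpectedRegret, gbpaExpectation, h1]
  have h3 : maxPotential (fun i => ∑ s : Fin T, g s i) ≤
      gbpaExpectation Φ g T (fun a => Φ (gbpaEstimate Φ g T a)) := by
    refine maxPotential_le fun i => ?_
    rw [← gbpaExpectation_gbpaEstimate hΦ hpos]
    exact gbpaExpectation_mono hΦ fun a => (le_maxPotential _ i).trans (hmax _)
  have h4 := gbpaExpectation_potential_le hΦ T hstep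
  linarith

end GBPA

/-! ### One round of GBPA with the Gaussian potential -/

/-- The gradient inequality for the smoothed potential in a coordinate direction: wherever `i`
leads after its score has been lowered by `c`, the maximum was higher by `c` before. -/
lemma gaussianPotential_sub_single_add_le {N : ℕ} (η : ℝ) {c : ℝ} (hc : 0 ≤ c)
    (G : Fin N → ℝ) (i : Fin N) :
    gaussianPotential N η (G - Pi.single i c) +
        c * (gaussianVector N).real (leaderSet η (G - Pi.single i c) i) ≤
      gaussianPotential N η G := by
  have : NeZero N := ⟨by rintro rfl; exact i.elim0⟩
  set H := G - Pi.single i c with hH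
  have hI := (integrable_indicator_leaderSet η H i).const_mul c
  have hHi : H i = G i - c := by simp [hH]
  have hHj : ∀ j, H j ≤ G j := fun j => by
    have : (0 : Fin N → ℝ) j ≤ (Pi.single i c : Fin N → ℝ) j := Pi.single_nonneg.2 hc j
    simp only [hH, Pi.sub_apply, Pi.zero_apply] at this ⊢
    linarith
  rw [← integral_indicator_leaderSet, ← integral_const_mul, gaussianPotential, gaussianPotential,
    ← integral_add (integrable_maxPotential η H) hI]
  refine integral_mono ((integrable_maxPotential η H).add hI) (integrable_maxPotential η G)
    fun z => ?_
  by_cases hz : z ∈ leaderSet η H i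
  · have h1 : maxPotential (H + η • z) = H i + η * z i :=
      maxPotential_eq_of_forall_lt (G := H + η • z) hz
    have h2 : G i + η * z i ≤ maxPotential (G + η • z) := le_maxPotential (G + η • z) i
    simp only [Set.indicator_of_mem hz, h1]
    linarith
  · simp only [Set.indicator_of_notMem hz, mul_zero, add_zero]
    refine maxPotential_le fun j => le_trans ?_ (le_maxPotential (G + η • z) j)
    exact add_le_add_left (hHj j) _

lemma gaussianPotential_round_le {n : ℕ} {η α : ℝ} (hη : 0 < η) (hα0 : 0 < α) (hα1 : α < 1)
    {x : Fin (n + 2) → ℝ} (hx : ∀ i, x i ∈ Set.Icc (-1 : ℝ) 0) (L : Fin (n + 2) → ℝ) :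
    ∑ k, potentialGradient (gaussianPotential (n + 2) η) L k * gaussianPotential (n + 2) η
        (L + Pi.single k (x k / potentialGradient (gaussianPotential (n + 2) η) L k)) ≤
      gaussianPotential (n + 2) η L +
        ∑ k, potentialGradient (gaussianPotential (n + 2) η) L k * x k +
        (n + 2 : ℕ) * (4 / α * (1 / η) ^ (1 - α)) := by
  simp only [potentialGradient_gaussianPotential hη]
  have hterm : ∀ k, (gaussianVector (n + 2)).real (leaderSet η L k) *
      gaussianPotential (n + 2) η
        (L + Pi.single k (x k / (gaussianVector (n + 2)).real (leaderSet η L k))) ≤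
      (gaussianVector (n + 2)).real (leaderSet η L k) * gaussianPotential (n + 2) η L +
        (gaussianVector (n + 2)).real (leaderSet η L k) * x k +
        4 / α * (1 / η) ^ (1 - α) := by
    intro k
    have hp := gaussianVector_real_leaderSet_pos hη L k
    set p := (gaussianVector (n + 2)).real (leaderSet η L k)
    have hxk := hx k
    set c := -x k / p with hcdef
    have hc0 : 0 ≤ c := div_nonneg (by linarith [hxk.2]) hp.le
    have hpc : p * c = -x k := mul_div_cancel₀ _ hp.ne'
    have hL : L + Pi.single k (x k / p) = L - Pi.single k c := by
      rw [hcdef, neg_div, Pi.single_neg, sub_neg_eq_add]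
    rw [hL]
    have h1 := gaussianPotential_sub_single_add_le η hc0 L k
    have h2 := gaussianVector_real_leaderSet_sub_le hη hα0 hα1 hc0 L k
    set p' := (gaussianVector (n + 2)).real (leaderSet η (L - Pi.single k c) k)
    -- `c ≤ 1 / p`, so the powers of `p` cancel
    have h3 : (c / η) ^ (1 - α) * p ^ (1 - α) ≤ (1 / η) ^ (1 - α) := by
      rw [← Real.mul_rpow (by positivity) hp.le]
      refine Real.rpow_le_rpow (by positivity) ?_ (by linarith)
      rw [div_mul_eq_mul_div, mul_comm c p, hpc]
      gcongr
      linarith [hxk.1]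
    have h4 : p - p' ≤ 4 / α * (1 / η) ^ (1 - α) := h2.trans (by gcongr)
    have hK : 0 ≤ 4 / α * (1 / η) ^ (1 - α) := by positivity
    have h5 : p * c * (p - p') ≤ 4 / α * (1 / η) ^ (1 - α) :=
      (mul_le_mul_of_nonneg_left h4 (by positivity)).trans
        (mul_le_of_le_one_left hK (by rw [hpc]; linarith [hxk.1]))
    have h6 := mul_le_mul_of_nonneg_left h1 hp.le
    have h7 : p * x k = -(p * (p * c)) := by rw [hpc]; ring
    rw [h7]
    nlinarith
  refine (Finset.sum_le_sum fun k _ => hterm k).trans (le_of_eq ?_)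
  rw [Finset.sum_add_distrib, Finset.sum_add_distrib, ← Finset.sum_mul,
    sum_gaussianVector_real_leaderSet hη, one_mul, Finset.sum_const, Finset.card_univ,
    Fintype.card_fin, nsmul_eq_mul]

theorem gbpaExpectedRegret_gaussianPotential_le {N : ℕ} (hN : 2 ≤ N) {η α : ℝ} (hη : 0 < η)
    (hα0 : 0 < α) (hα1 : α < 1) (T : ℕ) {g : ℕ → Fin N → ℝ}
    (hg : ∀ t < T, ∀ i, g t i ∈ Set.Icc (-1 : ℝ) 0) :
    gbpaExpectedRegret (gaussianPotential N η) g T ≤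
      η * √(2 * Real.log N) + T * (N * (4 / α * (1 / η) ^ (1 - α))) := by
  obtain ⟨n, rfl⟩ := Nat.exists_eq_add_of_le' hN
  refine (gbpaExpectedRegret_le (isGBPAPotential_gaussianPotential hη) (fun G i => ?_)
    (maxPotential_le_gaussianPotential η) T
    fun s hs L => gaussianPotential_round_le hη hα0 hα1 (hg s hs) L).trans ?_
  · rw [potentialGradient_gaussianPotential hη]
    exact gaussianVector_real_leaderSet_pos hη G i
  · gcongr
    exact gaussianPotential_zero_le hN hη.le

/-! ### Tuning the scale -/

lemma gaussianScale_pos {N T : ℕ} {α : ℝ} (hN : 2 ≤ N) (hT : 0 < T) (hα0 : 0 < α) (hα1 : α < 1) :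
    0 < gaussianScale N T α := by
  have hlog : 0 < Real.log N := Real.log_pos (by exact_mod_cast hN)
  have h1 : 0 < 1 - α := by linarith
  have h2 : (0 : ℝ) < T := by exact_mod_cast hT
  have h3 : (0 : ℝ) < N := by positivity
  unfold gaussianScale
  positivity

/-- The scale balances the two terms of the regret bound. -/
lemma gbpaExpectedRegret_gaussianScale_le {N T : ℕ} {α : ℝ} (hN : 2 ≤ N) (hT : 0 < T)
    (hα0 : 0 < α) (hα1 : α < 1) {g : ℕ → Fin N → ℝ}
    (hg : ∀ t < T, ∀ i, g t i ∈ Set.Icc (-1 : ℝ) 0) :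
    gbpaExpectedRegret (gaussianPotential N (gaussianScale N T α)) g T ≤
      2 * (gaussianScale N T α * √(2 * Real.log N)) := by
  have hη := gaussianScale_pos hN hT hα0 hα1
  have hlog : 0 < Real.log N := Real.log_pos (by exact_mod_cast hN)
  have h1 : 0 < 1 - α := by linarith
  have h2 : (0 : ℝ) < T := by exact_mod_cast hT
  have h3 : (0 : ℝ) < N := by positivity
  have hS : 0 < √(2 * Real.log N) := Real.sqrt_pos.2 (by linarith)
  have hpow : gaussianScale N T α ^ (2 - α) =
      4 * N * T / (α * (1 - α) * √(2 * Real.log N)) := by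
    rw [gaussianScale, ← Real.rpow_mul (by positivity), one_div_mul_cancel (by linarith),
      Real.rpow_one]
  refine (gbpaExpectedRegret_gaussianPotential_le hN hη hα0 hα1 T hg).trans ?_
  set η := gaussianScale N T α
  set S := √(2 * Real.log N)
  have hsplit : η ^ (2 - α) * (1 / η) ^ (1 - α) = η := by
    rw [one_div, Real.inv_rpow hη.le, ← Real.rpow_neg hη.le, ← Real.rpow_add hη]
    ring_nf
    exact Real.rpow_one η
  have h4 : (T : ℝ) * (N * (4 / α * (1 / η) ^ (1 - α))) ≤ η * S := by
    calc (T : ℝ) * (N * (4 / α * (1 / η) ^ (1 - α)))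
        = (1 - α) * (4 * N * T / (α * (1 - α) * S) * (1 / η) ^ (1 - α) * S) := by
          field_simp
      _ = (1 - α) * (η * S) := by rw [← hpow, hsplit]
      _ ≤ η * S := mul_le_of_le_one_left (by positivity) (by linarith)
  linarith

lemma three_halves_lt_log {T : ℕ} (hT : 4 < T) : 3 / 2 < Real.log T := by
  have h5 : (5 : ℝ) ≤ T := by exact_mod_cast hT
  rw [Real.lt_log_iff_exp_lt (by linarith)]
  refine lt_of_lt_of_le ?_ h5
  have h1 : Real.exp (3 / 2) ^ 2 = Real.exp 1 ^ 3 := by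
    rw [← Real.exp_nat_mul, ← Real.exp_nat_mul]
    norm_num
  have h2 : Real.exp 1 ^ 3 < 2.8 ^ 3 := by
    have := Real.exp_one_lt_d9
    gcongr
    linarith
  refine lt_of_pow_lt_pow_left₀ 2 (by norm_num) ?_
  rw [h1]
  exact h2.trans (by norm_num)

/-- The value of the balanced bound for `α = 1 / log T`, for which `T ^ α = e` is bounded. -/
lemma two_mul_gaussianScale_mul_le {N T : ℕ} (hN : 2 ≤ N) (hT : 4 < T) :
    2 * (gaussianScale N T (1 / Real.log T) * √(2 * Real.log N)) ≤
      96 * √((N : ℝ) * T) * (N : ℝ) ^ (1 / Real.log T) * √(Real.log N) * Real.log T := by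
  have hl := three_halves_lt_log hT
  set l := Real.log T with hldef
  have hl0 : 0 < l := by linarith
  set α := 1 / l with hα
  have hα0 : 0 < α := by positivity
  have hα23 : α ≤ 2 / 3 := by
    rw [hα, div_le_div_iff₀ hl0 (by norm_num)]
    linarith
  have hN2 : (2 : ℝ) ≤ N := by exact_mod_cast hN
  have hN0 : (0 : ℝ) < N := by linarith
  have hT0 : (0 : ℝ) < T := by exact_mod_cast (by omega : 0 < T)
  have hT1 : (1 : ℝ) ≤ T := by exact_mod_cast (by omega : 1 ≤ T)
  have hlogN : 1 / 2 ≤ Real.log N := by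
    have := Real.log_le_log (by norm_num) hN2
    linarith [Real.log_two_gt_d9]
  have hS1 : 1 ≤ √(2 * Real.log N) := Real.one_le_sqrt.2 (by linarith)
  have hS2 : √(2 * Real.log N) ≤ 2 * √(Real.log N) := by
    rw [Real.sqrt_mul (by norm_num)]
    gcongr
    rw [Real.sqrt_le_left (by norm_num)]
    norm_num
  set S := √(2 * Real.log N)
  set β := 1 / (2 - α) with hβ
  have h2α : 0 < 2 - α := by linarith
  have hβ1 : β ≤ 1 := by
    rw [hβ, div_le_one h2α]
    linarith
  have hβ0 : 0 < β := by positivity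
  have hβhalf : β ≤ 1 / 2 + α / 2 := by
    rw [hβ, div_le_iff₀ h2α]
    nlinarith
  have hY : (4 / (α * (1 - α) * S)) ^ β ≤ 12 * l := by
    have h1 : 4 / (α * (1 - α) * S) ≤ 12 * l := by
      have e1 : 1 / 3 * α ≤ α * (1 - α) * S := by
        nlinarith [mul_nonneg hα0.le (by linarith : (0 : ℝ) ≤ 1 - α)]
      calc 4 / (α * (1 - α) * S) ≤ 4 / (1 / 3 * α) := by gcongr
        _ = 12 * l := by rw [hα]; field_simp; norm_num
    have h0 : 0 ≤ 4 / (α * (1 - α) * S) := by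
      have : 0 < 1 - α := by linarith
      positivity
    calc (4 / (α * (1 - α) * S)) ^ β ≤ (12 * l) ^ β := by gcongr
      _ ≤ (12 * l) ^ (1 : ℝ) := Real.rpow_le_rpow_of_exponent_le (by linarith) hβ1
      _ = 12 * l := Real.rpow_one _
  have hNT : ((N : ℝ) * T) ^ β ≤ √((N : ℝ) * T) * (N : ℝ) ^ α * 2 := by
    have h1 : (1 : ℝ) ≤ N * T := by nlinarith
    have hTα : (T : ℝ) ^ (α / 2) ≤ 2 := by
      rw [Real.rpow_def_of_pos hT0, ← hldef, show l * (α / 2) = 1 / 2 by rw [hα]; field_simp]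
      have h2 : Real.exp (1 / 2) ^ 2 = Real.exp 1 := by
        rw [← Real.exp_nat_mul]
        norm_num
      have h3 := Real.exp_one_lt_d9
      refine le_of_sq_le_sq ?_ (by norm_num)
      rw [h2]
      linarith
    calc ((N : ℝ) * T) ^ β ≤ ((N : ℝ) * T) ^ (1 / 2 + α / 2) :=
          Real.rpow_le_rpow_of_exponent_le h1 hβhalf
      _ = √((N : ℝ) * T) * ((N : ℝ) ^ (α / 2) * (T : ℝ) ^ (α / 2)) := by
          rw [Real.rpow_add (by linarith), ← Real.sqrt_eq_rpow, Real.mul_rpow hN0.le hT0.le]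
      _ ≤ √((N : ℝ) * T) * ((N : ℝ) ^ α * 2) := by
          gcongr
          · linarith
          · linarith
      _ = √((N : ℝ) * T) * (N : ℝ) ^ α * 2 := by ring
  have hη : gaussianScale N T α = ((N : ℝ) * T) ^ β * (4 / (α * (1 - α) * S)) ^ β := by
    have : 0 < 1 - α := by linarith
    rw [← Real.mul_rpow (by positivity) (by positivity), gaussianScale]
    congr 1
    ring
  rw [hη]
  calc 2 * (((N : ℝ) * T) ^ β * (4 / (α * (1 - α) * S)) ^ β * S)
      ≤ 2 * ((√((N : ℝ) * T) * (N : ℝ) ^ α * 2) * (12 * l) * (2 * √(Real.log N))) := by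
        have : 0 < 1 - α := by linarith
        gcongr
    _ = 96 * √((N : ℝ) * T) * (N : ℝ) ^ α * √(Real.log N) * l := by ring

lemma natCast_rpow_one_div_log_le_exp {N T : ℕ} (hN : 0 < N) (hT : 4 < T) (hNT : N < T) :
    (N : ℝ) ^ (1 / Real.log T) ≤ Real.exp 1 := by
  have hl := three_halves_lt_log hT
  have hN0 : (0 : ℝ) < N := by exact_mod_cast hN
  rw [Real.rpow_def_of_pos hN0]
  apply Real.exp_le_exp.2
  rw [mul_one_div, div_le_one (by linarith)]
  exact Real.log_le_log hN0 (by exact_mod_cast hNT.le)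

lemma eventually_sqrt_mul_log_le (C : ℝ) {ε : ℝ} (hε : 0 < ε) :
    ∀ᶠ T : ℕ in atTop, C * (√(T : ℝ) * Real.log T) ≤ ε * T := by
  have h := ((isLittleO_log_rpow_atTop (r := 1 / 2) (by norm_num)).bound
    (show 0 < ε / (|C| + 1) by positivity))
  filter_upwards [tendsto_natCast_atTop_atTop.eventually h, eventually_ge_atTop 1] with T hT hT1
  have hT1' : (1 : ℝ) ≤ T := by exact_mod_cast hT1
  have hlog : 0 ≤ Real.log T := Real.log_nonneg hT1'
  rw [← Real.sqrt_eq_rpow, Real.norm_of_nonneg hlog, Real.norm_of_nonneg (Real.sqrt_nonneg _)] at hT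
  calc C * (√(T : ℝ) * Real.log T)
      ≤ (|C| + 1) * (√(T : ℝ) * (ε / (|C| + 1) * √(T : ℝ))) := by
        gcongr
        linarith [le_abs_self C]
    _ = ε * (√(T : ℝ) * √(T : ℝ)) := by field_simp
    _ = ε * T := by rw [Real.mul_self_sqrt (by linarith)]

theorem mainTheorem1 (N : ℕ) (hN : 2 ≤ N) :
    -- the tuned Gaussian potential is admissible in GBPA, and its gradient is the law of the
    -- leader under the scaled Gaussian perturbation
    (∀ T : ℕ, 4 < T →
      0 < gaussianScale N T (1 / Real.log T) ∧
      IsGBPAPotential (tunedGaussianPotential N T) ∧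
      ∀ (G : Fin N → ℝ) (i : Fin N),
        potentialGradient (tunedGaussianPotential N T) G i =
          (gaussianVector N).real
            {z | ∀ j, j ≠ i →
              G j + gaussianScale N T (1 / Real.log T) * z j <
                G i + gaussianScale N T (1 / Real.log T) * z i}) ∧
    -- the regret bound for `T > 4`
    (∀ T : ℕ, 4 < T → ∀ g : ℕ → Fin N → ℝ, (∀ t < T, ∀ i, g t i ∈ Set.Icc (-1 : ℝ) 0) →
      gbpaExpectedRegret (tunedGaussianPotential N T) g T ≤
        96 * √((N : ℝ) * T) * (N : ℝ) ^ (1 / Real.log T) * √(Real.log N) * Real.log T) ∧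
    -- the regret bound for `T > 4` and `T > N`
    (∀ T : ℕ, 4 < T → N < T →
      ∀ g : ℕ → Fin N → ℝ, (∀ t < T, ∀ i, g t i ∈ Set.Icc (-1 : ℝ) 0) →
      gbpaExpectedRegret (tunedGaussianPotential N T) g T ≤
        278 * √((N : ℝ) * T) * √(Real.log N) * Real.log T) ∧
    -- in particular the worst-case expected regret is sublinear in `T`
    (∀ ε : ℝ, 0 < ε → ∀ᶠ T : ℕ in atTop,
      ∀ g : ℕ → Fin N → ℝ, (∀ t < T, ∀ i, g t i ∈ Set.Icc (-1 : ℝ) 0) →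
      gbpaExpectedRegret (tunedGaussianPotential N T) g T ≤ ε * T) := by
  have : NeZero N := ⟨by omega⟩
  have hα : ∀ T : ℕ, 4 < T → 0 < 1 / Real.log T ∧ 1 / Real.log T < 1 := by
    intro T hT
    have hl := three_halves_lt_log hT
    exact ⟨by positivity, by rw [div_lt_one (by linarith)]; linarith⟩
  have hη : ∀ T : ℕ, 4 < T → 0 < gaussianScale N T (1 / Real.log T) := fun T hT =>
    gaussianScale_pos hN (by omega) (hα T hT).1 (hα T hT).2
  have hbound : ∀ T : ℕ, 4 < T → ∀ g : ℕ → Fin N → ℝ,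
      (∀ t < T, ∀ i, g t i ∈ Set.Icc (-1 : ℝ) 0) →
      gbpaExpectedRegret (tunedGaussianPotential N T) g T ≤
        96 * √((N : ℝ) * T) * (N : ℝ) ^ (1 / Real.log T) * √(Real.log N) * Real.log T :=
    fun T hT g hg =>
      (gbpaExpectedRegret_gaussianScale_le hN (by omega) (hα T hT).1 (hα T hT).2 hg).trans
        (two_mul_gaussianScale_mul_le hN hT)
  have hbound' : ∀ T : ℕ, 4 < T → N < T → ∀ g : ℕ → Fin N → ℝ,
      (∀ t < T, ∀ i, g t i ∈ Set.Icc (-1 : ℝ) 0) →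
      gbpaExpectedRegret (tunedGaussianPotential N T) g T ≤
        278 * √((N : ℝ) * T) * √(Real.log N) * Real.log T := by
    intro T hT hNT g hg
    have hl := three_halves_lt_log hT
    calc gbpaExpectedRegret (tunedGaussianPotential N T) g T
        ≤ 96 * √((N : ℝ) * T) * (N : ℝ) ^ (1 / Real.log T) * √(Real.log N) * Real.log T :=
          hbound T hT g hg
      _ = 96 * (N : ℝ) ^ (1 / Real.log T) * (√((N : ℝ) * T) * √(Real.log N) * Real.log T) := by
          ring
      _ ≤ 278 * (√((N : ℝ) * T) * √(Real.log N) * Real.log T) := by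
          gcongr
          linarith [natCast_rpow_one_div_log_le_exp (by omega) hT hNT, Real.exp_one_lt_d9]
      _ = 278 * √((N : ℝ) * T) * √(Real.log N) * Real.log T := by ring
  refine ⟨fun T hT => ⟨hη T hT, isGBPAPotential_gaussianPotential (hη T hT), fun G i =>
    potentialGradient_gaussianPotential (hη T hT) G i⟩, hbound, hbound', fun ε hε => ?_⟩
  filter_upwards [eventually_gt_atTop 4, eventually_gt_atTop N,
    eventually_sqrt_mul_log_le (278 * √(N : ℝ) * √(Real.log N)) hε] with T hT hNT hlim g hg
  refine (hbound' T hT hNT g hg).trans (le_of_eq_of_le ?_ hlim)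
  rw [Real.sqrt_mul (Nat.cast_nonneg N)]
  ring
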